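/- Definitions. A clutter $\mathcal C$ is a family of subsets (members) of a finite ground set $V$, none of which contains another. A cover of $\mathcal C$ is a subset of $V$ that intersects every member; a cover is minimal if it contains no other cover, and the minimal covers form a clutter over $V$, the blocker of $\mathcal C$. The covering number is the minimum cardinality of a cover, and a minimum cover is a cover of that cardinality. For disjoint $I,J\subseteq V$, the minor $\mathcal C\setminus I/J$ is the clutter over $V-(I\cup J)$ whose members are the inclusion-wise minimal sets of $\{C-J: C\in\mathcal C,\ C\cap I=\emptyset\}$. A delta is a clutter over a ground set $\{a_1,\dots,a_n\}$ with $n\ge 3$ elements whose members are $\{a_2,\dots,a_n\}$ and $\{a_1,a_i\}$, $i=2,\dots,n$. An extended odd hole is a clutter over a ground set $\{a_1,\dots,a_n\}$ with $n\ge 5$ elements, $n$ odd, whose minimum cardinality members are exactly $\{a_1,a_2\},\dots,\{a_{n-1},a_n\},\{a_n,a_1\}$. A clutter is clean if none of its minors is a delta or the blocker of an extended odd hole. It is tangled if its covering number is two and every element belongs to a minimum cover. For a clean tangled clutter $\mathcal C$, let $G(\mathcal C)$ be the graph with vertex set $V$ whose edges are the minimum covers of $\mathcal C$; it is known to be bipartite.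 The rank of $\mathcal C$ is the number of connected components of $G(\mathcal C)$. Theorem. Let $\mathcal C$ be a clean tangled clutter of rank $r$, and for each $i\in\{1,\dots,r\}$ denote by $\{U_i,V_i\}$ the bipartition of the $i$-th connected component of $G(\mathcal C)$ (the components are numbered, and the two sides of each are named, arbitrarily). Suppose that for some integer $k$ with $1\le k\le r$ the set $V_1\cup\dots\cup V_k$ is a cover of $\mathcal C$. Then $k\ge 3$. Moreover, if $k=3$, then $V_1\cup V_2\cup V_3$ contains a minimal cover of $\mathcal C$ of cardinality three that has exactly one element in each of $V_1,V_2,V_3$. -/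

import Mathlib

/-- A clutter: a family of subsets (the members) of a finite ground set,
none of which contains another one. -/
@[ext]
structure Clutter (α : Type*) where
  ground : Finset α
  members : Set (Finset α)
  subset_ground : ∀ A ∈ members, A ⊆ ground
  antichain : IsAntichain (· ⊆ ·) members

namespace Clutter

variable {α : Type*}

/-- A cover: a subset of the ground set that meets every member. -/
def IsCover (C : Clutter α) (B : Finset α) : Prop :=
  B ⊆ C.ground ∧ ∀ A ∈ C.members, ¬ Disjoint B A

/-- An inclusion-wise minimal cover. -/
def IsMinimalCover (C : Clutter α) (B : Finset α) : Prop :=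
  Minimal C.IsCover B

/-- A cover of minimum cardinality. -/
def IsMinimumCover (C : Clutter α) (B : Finset α) : Prop :=
  C.IsCover B ∧ ∀ B', C.IsCover B' → B.card ≤ B'.card

/-- The covering number: the minimum cardinality of a cover (`⊤` when there is no cover). -/
noncomputable def coveringNumber (C : Clutter α) : ℕ∞ :=
  ⨅ B ∈ {B | C.IsCover B}, (B.card : ℕ∞)

/-- The blocker: the clutter of the minimal covers, over the same ground set. -/
def blocker (C : Clutter α) : Clutter α where
  ground := C.ground
  members := {B | C.IsMinimalCover B}
  subset_ground := fun _ hA => hA.prop.1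
  antichain := setOfPred_minimal_antichain C.IsCover

/-- The minor obtained by deleting `I` and contracting `J`: its members are the inclusion-wise
minimal sets among `A \ J`, where `A` is a member disjoint from `I`. -/
def minor [DecidableEq α] (C : Clutter α) (I J : Finset α) : Clutter α where
  ground := C.ground \ (I ∪ J)
  members := {B | Minimal (fun B => ∃ A ∈ C.members, Disjoint A I ∧ B = A \ J) B}
  subset_ground := by
    intro B hB x hx
    rw [Set.mem_ofPred_eq] at hB
    obtain ⟨A, hA, hAI, rfl⟩ := hB.prop
    rw [Finset.mem_sdiff] at hx
    rw [Finset.mem_sdiff, Finset.mem_union, not_or]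
    exact ⟨C.subset_ground A hA hx.1, Finset.disjoint_left.mp hAI hx.1, hx.2⟩
  antichain := setOfPred_minimal_antichain _

/-- `D` is a minor of `C`: it arises by deleting and contracting disjoint sets of elements. -/
def IsMinor [DecidableEq α] (D C : Clutter α) : Prop :=
  ∃ I J : Finset α, I ⊆ C.ground ∧ J ⊆ C.ground ∧ Disjoint I J ∧ D = C.minor I J

/-- A delta: at least three elements `a, x₂, …, xₙ`, with members `{x₂, …, xₙ}` and
`{a, x₂}, …, {a, xₙ}`. -/
def IsDelta [DecidableEq α] (C : Clutter α) : Prop :=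
  3 ≤ C.ground.card ∧ ∃ a ∈ C.ground,
    C.members = {C.ground.erase a} ∪ {A | ∃ x ∈ C.ground.erase a, A = {a, x}}

/-- An extended odd hole: the ground set consists of `n` elements `a i` (`i ∈ ℤ/n`), with `n ≥ 5`
odd, and the members of minimum cardinality are exactly the sets `{a i, a (i + 1)}`. -/
def IsExtendedOddHole [DecidableEq α] (C : Clutter α) : Prop :=
  ∃ n : ℕ, 5 ≤ n ∧ Odd n ∧ ∃ a : ZMod n → α, Function.Injective a ∧
    Set.range a = (C.ground : Set α) ∧
    {A | A ∈ C.members ∧ ∀ B ∈ C.members, A.card ≤ B.card} =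
      Set.range fun i : ZMod n => ({a i, a (i + 1)} : Finset α)

/-- A clutter is clean if no minor of it is a delta or the blocker of an extended odd hole. -/
def IsClean [DecidableEq α] (C : Clutter α) : Prop :=
  ∀ D : Clutter α, D.IsMinor C →
    ¬ D.IsDelta ∧ ¬ ∃ H : Clutter α, H.IsExtendedOddHole ∧ D = H.blocker

/-- A clutter is tangled if its covering number is two and every element belongs to a
minimum cover. -/
def IsTangled (C : Clutter α) : Prop :=
  C.coveringNumber = 2 ∧ ∀ v ∈ C.ground, ∃ B, C.IsMinimumCover B ∧ v ∈ B

/-- The graph `G(C)` on the ground set of `C`: two distinct elements are adjacent when they form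
a minimum cover. -/
def graph [DecidableEq α] (C : Clutter α) : SimpleGraph {v // v ∈ C.ground} where
  Adj u v := u ≠ v ∧ C.IsMinimumCover {u.1, v.1}
  symm := ⟨fun u v h => ⟨h.1.symm, by rw [Finset.pair_comm]; exact h.2⟩⟩
  loopless := ⟨fun _ h => h.1 rfl⟩

/-- The rank: the number of connected components of `G(C)`. -/
noncomputable def rank [DecidableEq α] (C : Clutter α) : ℕ :=
  Nat.card C.graph.ConnectedComponent

/-- `{U, V}` is the bipartition of the connected component `K` of `G(C)`: the sets `U`, `V`
partition the vertices of `K`, and every edge of `K` joins `U` and `V`. -/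
def IsComponentBipartition [DecidableEq α] (C : Clutter α) (K : C.graph.ConnectedComponent)
    (U V : Finset α) : Prop :=
  Disjoint U V ∧ ((U ∪ V : Finset α) : Set α) = Subtype.val '' K.supp ∧
    ∀ x y : {v // v ∈ C.ground}, x ∈ K.supp → C.graph.Adj x y →
      (x.1 ∈ U ∧ y.1 ∈ V) ∨ (x.1 ∈ V ∧ y.1 ∈ U)

end Clutter

namespace Clutter

/-! Let `M` be a cover of least cardinality among those inside `V₁ ∪ ⋯ ∪ Vₖ`. Every edge of `G(C)`
crosses the bipartition of its component, so no two-element cover fits in this union and `|M| ≥ 3`.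
The main point is that `M` meets each `Vᵢ` at most once; then `3 ≤ |M| ≤ k`, and for `k = 3`
equality forces one element in each side.

Two elements of `M` in one `Vᵢ` would be joined by an even walk in `G(C)` alternating between the
union and its complement. `IsClean.no_alternating_walk` rules this out by induction on length.
Length two gives a delta (`IsClean.eq_of_hits_pairs`). For longer walks, part of `M` is deleted, as
much as possible without creating one-element covers. Either the two ends become a cover themselves
and close an odd walk, impossible by `IsClean.no_odd_closed`, or a shorter alternating walk appears.
Since deletions accumulate, the lemmas carry a deleted set `J`: the sets `X` with `C.Hits (X ∪ J)`
play the role of the covers after deletion. -/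

/-- A set that meets every member. -/
def Hits {α : Type*} (C : Clutter α) (X : Finset α) : Prop :=
  ∀ A ∈ C.members, ¬ Disjoint X A

theorem Hits.mono {α : Type*} {C : Clutter α} {X Y : Finset α} (h : C.Hits X) (hXY : X ⊆ Y) :
    C.Hits Y :=
  fun A hA hd => h A hA (Finset.disjoint_of_subset_left hXY hd)

/-! ### Covers, blockers and minors -/

theorem members_subset_iff {α : Type*} [DecidableEq α] (D : Clutter α) (A : Finset α) :
    (∃ B ∈ D.members, B ⊆ A) ↔ ¬ D.IsCover (D.ground \ A) := by
  constructor
  · rintro ⟨B, hB, hBA⟩ hc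
    refine hc.2 B hB ?_
    rw [Finset.disjoint_left]
    intro x hx hxB
    exact (Finset.mem_sdiff.mp hx).2 (hBA hxB)
  · intro h
    by_contra! hn
    refine h ⟨Finset.sdiff_subset, fun B hB hd => hn B hB fun x hx => ?_⟩
    by_contra hxA
    exact Finset.disjoint_left.mp hd
      (Finset.mem_sdiff.mpr ⟨D.subset_ground B hB hx, hxA⟩) hx

/-- A clutter is determined by its covers. -/
theorem mem_members_iff_minimal {α : Type*} [DecidableEq α] (D : Clutter α) {A : Finset α} :
    A ∈ D.members ↔ Minimal (fun A => A ⊆ D.ground ∧ ¬ D.IsCover (D.ground \ A)) A := by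
  constructor
  · intro hA
    refine ⟨⟨D.subset_ground A hA, (D.members_subset_iff A).mp
      ⟨A, hA, subset_rfl⟩⟩, ?_⟩
    rintro B ⟨hB, hBc⟩ hBA
    obtain ⟨E, hE, hEB⟩ := (D.members_subset_iff B).mpr hBc
    have : E = A := D.antichain.eq hE hA (hEB.trans hBA)
    exact this ▸ hEB
  · rintro ⟨⟨hA, hAc⟩, hmin⟩
    obtain ⟨E, hE, hEA⟩ := (D.members_subset_iff A).mpr hAc
    have : A ≤ E := hmin ⟨D.subset_ground E hE,
      (D.members_subset_iff E).mp ⟨E, hE, subset_rfl⟩⟩ hEA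
    exact (subset_antisymm hEA this) ▸ hE

theorem blocker_blocker {α : Type*} [DecidableEq α] (D : Clutter α) : D.blocker.blocker = D := by
  refine Clutter.ext rfl (Set.ext fun A => ?_)
  rw [mem_members_iff_minimal D]
  have key : ∀ A, D.blocker.IsCover A ↔ A ⊆ D.ground ∧ ¬ D.IsCover (D.ground \ A) := by
    intro A
    refine and_congr Iff.rfl ⟨fun h hc => ?_, fun h B hB hd => h ?_⟩
    · obtain ⟨B, hB, hBmin⟩ := exists_minimal_le_of_wellFoundedLT D.IsCover _ hc
      refine h B hBmin ?_
      rw [Finset.disjoint_right]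
      intro x hx
      exact (Finset.mem_sdiff.mp (hB hx)).2
    · refine ⟨Finset.sdiff_subset, fun E hE hdE => hB.prop.2 E hE ?_⟩
      refine Finset.disjoint_of_subset_left (fun x hx => ?_) hdE
      exact Finset.mem_sdiff.mpr ⟨hB.prop.1 hx, Finset.disjoint_right.mp hd hx⟩
  change Minimal D.blocker.IsCover A ↔ _
  rw [show D.blocker.IsCover = fun A => A ⊆ D.ground ∧ ¬ D.IsCover (D.ground \ A) from
    funext fun A => propext (key A)]

theorem minor_ground_of_subset {α : Type*} [DecidableEq α] (C : Clutter α) {S J : Finset α}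
    (hS : S ⊆ C.ground) (hSJ : Disjoint S J) :
    (C.minor J (C.ground \ (S ∪ J))).ground = S := by
  ext x
  have h1 := @hS x
  have h2 : x ∈ S → x ∉ J := fun h => Finset.disjoint_left.mp hSJ h
  simp only [minor, Finset.mem_sdiff, Finset.mem_union]
  tauto

/-- Deleting `J` amounts to having `J` for free in every cover; contracting the rest amounts to
confining covers to `S`. -/
theorem minor_isCover_iff {α : Type*} [DecidableEq α] (C : Clutter α) {S J X : Finset α}
    (hS : S ⊆ C.ground) (hSJ : Disjoint S J) :
    (C.minor J (C.ground \ (S ∪ J))).IsCover X ↔ X ⊆ S ∧ C.Hits (X ∪ J) := by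
  unfold IsCover
  rw [minor_ground_of_subset C hS hSJ]
  refine and_congr_right fun hXS => ⟨fun h A hA hd => ?_, fun h B hB hd => ?_⟩
  · rw [Finset.disjoint_union_left] at hd
    obtain ⟨B, hBle, hB⟩ := exists_minimal_le_of_wellFoundedLT
      (fun B => ∃ A ∈ C.members, Disjoint A J ∧ B = A \ (C.ground \ (S ∪ J)))
      (A \ (C.ground \ (S ∪ J))) ⟨A, hA, hd.2.symm, rfl⟩
    exact h B hB (Finset.disjoint_of_subset_right (hBle.trans Finset.sdiff_subset) hd.1)
  · change Minimal (fun B => ∃ A ∈ C.members, Disjoint A J ∧ B = A \ (C.ground \ (S ∪ J))) B at hB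
    obtain ⟨A, hA, hAJ, rfl⟩ := hB.prop
    refine h A hA (Finset.disjoint_union_left.mpr ⟨?_, hAJ.symm⟩)
    rw [Finset.disjoint_left] at hd ⊢
    intro x hx hxA
    refine hd hx (Finset.mem_sdiff.mpr ⟨hxA, fun hxI => ?_⟩)
    exact (Finset.mem_sdiff.mp hxI).2 (Finset.mem_union_left _ (hXS hx))

theorem minor_isMinor {α : Type*} [DecidableEq α] (C : Clutter α) {S J : Finset α}
    (hJ : J ⊆ C.ground) : (C.minor J (C.ground \ (S ∪ J))).IsMinor C := by
  refine ⟨J, _, hJ, Finset.sdiff_subset, ?_, rfl⟩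
  rw [Finset.disjoint_left]
  intro x hx hx'
  exact (Finset.mem_sdiff.mp hx').2 (Finset.mem_union_right _ hx)

/-! ### Deltas -/

/-- A delta is its own blocker, so it is recognised by its covers, which are what
`minor_isCover_iff` computes. -/
theorem isDelta_of_isCover_iff {α : Type*} [DecidableEq α] (D : Clutter α) {a : α}
    {N : Finset α} (haN : a ∉ N) (hN : 2 ≤ N.card) (hground : D.ground = insert a N)
    (hcover : ∀ X ⊆ insert a N, D.IsCover X ↔ N ⊆ X ∨ (a ∈ X ∧ ∃ x ∈ N, x ∈ X)) :
    D.IsDelta := by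
  have herase : D.ground.erase a = N := by rw [hground, Finset.erase_insert haN]
  refine ⟨by rw [hground, Finset.card_insert_of_notMem haN]; omega, a, by simp [hground], ?_⟩
  rw [herase]
  have hNne : ∃ x, x ∈ N := Finset.card_pos.mp (by omega)
  have key : ∀ A, (A ⊆ D.ground ∧ ¬ D.IsCover (D.ground \ A)) ↔
      A ⊆ insert a N ∧ (∃ x ∈ N, x ∈ A) ∧ (a ∈ A ∨ N ⊆ A) := by
    intro A
    rw [hground, hcover _ Finset.sdiff_subset]
    refine and_congr_right fun hA => ?_
    have e1 : N ⊆ insert a N \ A ↔ ¬ ∃ x ∈ N, x ∈ A := by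
      constructor
      · rintro h ⟨x, hx, hxA⟩
        exact (Finset.mem_sdiff.mp (h hx)).2 hxA
      · intro h x hx
        exact Finset.mem_sdiff.mpr ⟨Finset.mem_insert_of_mem hx, fun hxA => h ⟨x, hx, hxA⟩⟩
    have e2 : (∃ x ∈ N, x ∈ insert a N \ A) ↔ ¬ N ⊆ A := by
      rw [Finset.not_subset]
      refine exists_congr fun x => and_congr_right fun hx => ?_
      simp [hx]
    have e3 : a ∈ insert a N \ A ↔ a ∉ A := by simp
    rw [e1, e2, e3, not_or, not_not, not_and_or, not_not, not_not]
  ext A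
  rw [mem_members_iff_minimal, show (fun A => A ⊆ D.ground ∧ ¬ D.IsCover (D.ground \ A)) = _ from
    funext fun A => propext (key A)]
  constructor
  · rintro ⟨⟨hA, ⟨x, hx, hxA⟩, h⟩, hmin⟩
    rcases h with h | h
    · right
      refine ⟨x, hx, subset_antisymm (hmin ⟨?_, ⟨x, hx, by simp⟩, by simp⟩ ?_) ?_⟩
      all_goals
        intro y hy
        rcases Finset.mem_insert.mp hy with rfl | hy
        · simp_all
        · simp_all
    · left
      exact subset_antisymm (hmin ⟨Finset.subset_insert _ _, ⟨x, hx, hx⟩, Or.inr subset_rfl⟩ h) h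
  · rintro (h | ⟨x, hx, h⟩)
    · obtain rfl : A = N := h
      refine ⟨⟨Finset.subset_insert _ _, ?_, Or.inr subset_rfl⟩, ?_⟩
      · obtain ⟨x, hx⟩ := hNne
        exact ⟨x, hx, hx⟩
      · rintro B ⟨hB, -, h | h⟩ hBA
        · exact absurd (hBA h) haN
        · exact h
    · subst h
      refine ⟨⟨?_, ⟨x, hx, by simp⟩, by simp⟩, ?_⟩
      · intro y hy
        simp only [Finset.mem_insert, Finset.mem_singleton] at hy ⊢
        rcases hy with rfl | rfl <;> simp [hx]
      · rintro B ⟨hB, ⟨y, hy, hyB⟩, h⟩ hBA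
        have hya : y ≠ a := fun e => haN (e ▸ hy)
        have hyx : y = x := by
          have := hBA hyB
          simp only [Finset.mem_insert, Finset.mem_singleton] at this
          tauto
        subst hyx
        have haB : a ∈ B := by
          rcases h with h | h
          · exact h
          · obtain ⟨z, hz, hzy⟩ := Finset.exists_mem_ne (by omega : 1 < N.card) y
            have := hBA (h hz)
            simp only [Finset.mem_insert, Finset.mem_singleton] at this
            rcases this with rfl | rfl
            · exact absurd hz haN
            · exact absurd rfl hzy
        intro z hz
        simp only [Finset.mem_insert, Finset.mem_singleton] at hz
        rcases hz with rfl | rfl <;> assumption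

/-- In a clean clutter, an element outside a minimal cover forms a two-element cover with at most
one element of it; stated after deleting `J`. -/
theorem IsClean.eq_of_hits_pairs {α : Type*} [DecidableEq α] {C : Clutter α} (hC : C.IsClean)
    {J M : Finset α} {u v w : α} (hJ : J ⊆ C.ground) (hM : M ⊆ C.ground) (hu : u ∈ C.ground)
    (hMJ : Disjoint M J) (huM : u ∉ M) (huJ : u ∉ J) (hMhit : C.Hits (M ∪ J))
    (hmin : ∀ X ⊆ M, C.Hits (X ∪ J) → X = M) (hsing : ¬ C.Hits (insert u J))
    (hv : v ∈ M) (hw : w ∈ M) (huv : C.Hits (insert u (insert v J)))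
    (huw : C.Hits (insert u (insert w J))) : v = w := by
  by_contra hvw
  classical
  -- With `K` maximal such that `K ∪ J` and `u` do not cover, deleting `K` makes `u` form a cover
  -- with each element of `M \ K`, but not alone. By minimality of `M`, the only cover inside `M \
  -- K` is `M \ K` itself. On `insert u (M \ K)` this is a delta; `v` and `w` are outside `K`, so it
  -- is large enough.
  obtain ⟨K, hK⟩ := (M.powerset.filter fun K => ¬ C.Hits (insert u (K ∪ J))).exists_maximal
    ⟨∅, by simpa using hsing⟩
  obtain ⟨hKM, hKu⟩ : K ⊆ M ∧ ¬ C.Hits (insert u (K ∪ J)) := by simpa using hK.prop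
  have hmax : ∀ x ∈ M, x ∉ K → C.Hits (insert u (insert x (K ∪ J))) := by
    intro x hx hxK
    by_contra h
    refine hxK (hK.le_of_ge (y := insert x K) ?_ (Finset.subset_insert _ _)
      (Finset.mem_insert_self _ _))
    simp only [Finset.mem_filter, Finset.mem_powerset, Finset.insert_union]
    exact ⟨Finset.insert_subset hx hKM, h⟩
  have hout : ∀ x, C.Hits (insert u (insert x J)) → x ∉ K := by
    refine fun x hx hxK => hKu (hx.mono (Finset.insert_subset_insert _ ?_))
    exact Finset.insert_subset (Finset.mem_union_left _ hxK) Finset.subset_union_right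
  have huK : u ∉ K := fun h => huM (hKM h)
  have hsub : insert u (M \ K) ⊆ C.ground :=
    Finset.insert_subset hu (Finset.sdiff_subset.trans hM)
  have hdisj : Disjoint (insert u (M \ K)) (K ∪ J) := by
    rw [Finset.disjoint_insert_left, Finset.mem_union, Finset.disjoint_union_right]
    exact ⟨by tauto, Finset.sdiff_disjoint, Finset.disjoint_of_subset_left Finset.sdiff_subset hMJ⟩
  refine (hC _ (minor_isMinor C (S := insert u (M \ K))
    (Finset.union_subset (hKM.trans hM) hJ))).1 (isDelta_of_isCover_iff _ (a := u) (N := M \ K)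
      (by simp [huM]) ?_ (minor_ground_of_subset C hsub hdisj) ?_)
  · refine Finset.one_lt_card.mpr ⟨v, ?_, w, ?_, hvw⟩
    · exact Finset.mem_sdiff.mpr ⟨hv, hout v huv⟩
    · exact Finset.mem_sdiff.mpr ⟨hw, hout w huw⟩
  · intro X hX
    rw [minor_isCover_iff C hsub hdisj]
    constructor
    · rintro ⟨-, hhit⟩
      by_cases huX : u ∈ X
      · refine Or.inr ⟨huX, ?_⟩
        by_contra! hn
        refine hKu (hhit.mono (Finset.union_subset (fun y hy => ?_)
          (Finset.subset_insert _ _)))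
        rcases Finset.mem_insert.mp (hX hy) with rfl | hy'
        · exact Finset.mem_insert_self _ _
        · exact absurd hy (hn y hy')
      · have hXM : X ⊆ M \ K := (Finset.subset_insert_iff_of_notMem huX).mp hX
        rw [← Finset.union_assoc] at hhit
        have := hmin (X ∪ K) (Finset.union_subset (hXM.trans Finset.sdiff_subset) hKM) hhit
        refine Or.inl fun y hy => ?_
        rw [← this] at hy
        simp only [Finset.mem_sdiff, Finset.mem_union] at hy
        tauto
    · refine fun h => ⟨hX, ?_⟩
      rcases h with h | ⟨huX, x, hx, hxX⟩
      · refine hMhit.mono fun y hy => ?_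
        by_cases hyK : y ∈ K
        · simp [hyK]
        · rcases Finset.mem_union.mp hy with hy | hy
          · exact Finset.mem_union_left _ (h (Finset.mem_sdiff.mpr ⟨hy, hyK⟩))
          · simp [hy]
      · obtain ⟨hxM, hxK⟩ := Finset.mem_sdiff.mp hx
        refine (hmax x hxM hxK).mono ?_
        exact Finset.insert_subset (Finset.mem_union_left _ huX)
          (Finset.insert_subset (Finset.mem_union_left _ hxX) Finset.subset_union_right)

/-! ### Odd closed walks and extended odd holes -/

/-- A repeated vertex or a chord splits an odd closed walk into two shorter closed walks, whose
lengths sum to `n` or `n + 2`; one of them is odd. -/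
theorem exists_chordless_odd_closed {α : Type*} (R : α → α → Prop) (hsymm : ∀ x y, R x y → R y x)
    (hirr : ∀ x, ¬ R x x) {n : ℕ} (hn : Odd n) (a : ℕ → α) (ha : ∀ i < n, R (a i) (a (i + 1)))
    (hclosed : a n = a 0) :
    ∃ m, 3 ≤ m ∧ Odd m ∧ ∃ b : ℕ → α, (∀ i, i ≤ m → ∃ j ≤ n, b i = a j) ∧
      (∀ i < m, R (b i) (b (i + 1))) ∧ b m = b 0 ∧
      (∀ i j, i < j → j < m → b i ≠ b j) ∧
      (∀ i j, i < j → j < m → R (b i) (b j) → j = i + 1 ∨ (i = 0 ∧ j = m - 1)) := by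
  induction n using Nat.strong_induction_on generalizing a with
  | _ n ih =>
  have hlift : ∀ n' < n, Odd n' → ∀ a' : ℕ → α, (∀ i < n', R (a' i) (a' (i + 1))) →
      a' n' = a' 0 → (∀ i ≤ n', ∃ j ≤ n, a' i = a j) →
      ∃ m, 3 ≤ m ∧ Odd m ∧ ∃ b : ℕ → α, (∀ i, i ≤ m → ∃ j ≤ n, b i = a j) ∧
      (∀ i < m, R (b i) (b (i + 1))) ∧ b m = b 0 ∧
      (∀ i j, i < j → j < m → b i ≠ b j) ∧
      (∀ i j, i < j → j < m → R (b i) (b j) → j = i + 1 ∨ (i = 0 ∧ j = m - 1)) := by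
    intro n' hn' hodd a' ha' hc hval
    obtain ⟨m, h3, hm, b, hb, hrest⟩ := ih n' hn' hodd a' ha' hc
    refine ⟨m, h3, hm, b, fun i hi => ?_, hrest⟩
    obtain ⟨j, hj, hbj⟩ := hb i hi
    obtain ⟨l, hl, hal⟩ := hval j hj
    exact ⟨l, hl, hbj.trans hal⟩
  by_cases heq : ∃ i j, i < j ∧ j < n ∧ a i = a j
  · obtain ⟨i, j, hij, hj, he⟩ := heq
    by_cases hodd : Odd (j - i)
    · refine hlift (j - i) (by omega) hodd (fun k => a (i + k)) (fun k hk => ?_) ?_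
        (fun k hk => ⟨i + k, by omega, rfl⟩)
      · exact ha (i + k) (by omega)
      · simp only [add_zero, Nat.add_sub_cancel' hij.le, he]
    · refine hlift (n - (j - i)) (by omega) (by grind)
        (fun k => if k ≤ i then a k else a (k + (j - i))) (fun k hk => ?_) ?_ (fun k hk => ?_)
      · rcases lt_trichotomy k i with h | rfl | h
        · simpa [h.le, Nat.succ_le_of_lt h] using ha k (by omega)
        · have := ha j (by omega)
          simp only [le_refl, if_true, show ¬ k + 1 ≤ k by omega, if_false]
          rwa [he, show k + 1 + (j - k) = j + 1 by omega]
        · have := ha (k + (j - i)) (by omega)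
          simp only [show ¬ k ≤ i by omega, show ¬ k + 1 ≤ i by omega, if_false]
          rwa [show k + 1 + (j - i) = k + (j - i) + 1 by omega]
      · simp only [show ¬ n - (j - i) ≤ i by omega, if_false, zero_le, if_true]
        rw [show n - (j - i) + (j - i) = n by omega, hclosed]
      · by_cases h : k ≤ i
        · exact ⟨k, by omega, by simp [h]⟩
        · exact ⟨k + (j - i), by omega, by simp [h]⟩
  by_cases hch : ∃ i j, i < j ∧ j < n ∧ R (a i) (a j) ∧ j ≠ i + 1 ∧ ¬ (i = 0 ∧ j = n - 1)
  · obtain ⟨i, j, hij, hj, hR, h1, h2⟩ := hch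
    by_cases hodd : Odd (j - i + 1)
    · refine hlift (j - i + 1) (by omega) hodd (fun k => if k ≤ j - i then a (i + k) else a i)
        (fun k hk => ?_) ?_ (fun k hk => ?_)
      · rcases Nat.lt_or_ge k (j - i) with h | h
        · simpa [← add_assoc, h.le, Nat.succ_le_of_lt h] using ha (i + k) (by omega)
        · obtain rfl : k = j - i := by omega
          simp only [le_refl, if_true, show ¬ j - i + 1 ≤ j - i by omega, if_false,
            Nat.add_sub_cancel' hij.le]
          exact hsymm _ _ hR
      · simp
      · by_cases h : k ≤ j - i
        · exact ⟨i + k, by omega, by simp [h]⟩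
        · exact ⟨i, by omega, by simp [h]⟩
    · refine hlift (n - (j - i) + 1) (by omega) (by grind)
        -- The shift is one less than `j - i` because the chord from `a i` to `a j` is itself a
        -- step.
        (fun k => if k ≤ i then a k else a (k + (j - i) - 1)) (fun k hk => ?_) ?_ (fun k hk => ?_)
      · rcases lt_trichotomy k i with h | rfl | h
        · simpa [h.le, Nat.succ_le_of_lt h] using ha k (by omega)
        · simp only [le_refl, if_true, show ¬ k + 1 ≤ k by omega, if_false]
          rwa [show k + 1 + (j - k) - 1 = j by omega]
        · have := ha (k + (j - i) - 1) (by omega)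
          simp only [show ¬ k ≤ i by omega, show ¬ k + 1 ≤ i by omega, if_false]
          rwa [show k + 1 + (j - i) - 1 = k + (j - i) - 1 + 1 by omega]
      · simp only [show ¬ n - (j - i) + 1 ≤ i by omega, if_false, zero_le, if_true]
        rw [show n - (j - i) + 1 + (j - i) - 1 = n by omega, hclosed]
      · by_cases h : k ≤ i
        · exact ⟨k, by omega, by simp [h]⟩
        · exact ⟨k + (j - i) - 1, by omega, by simp [h]⟩
  · push Not at heq hch
    refine ⟨n, ?_, hn, a, fun i hi => ⟨i, hi, rfl⟩, ha, hclosed, heq, fun i j hij hj hR => ?_⟩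
    · by_contra h
      obtain rfl : n = 1 := by grind
      have := ha 0 (by omega)
      rw [zero_add, hclosed] at this
      exact hirr _ this
    · by_contra! hne
      exact hne.2 (hch i j hij hj hR hne.1).1 (hch i j hij hj hR hne.1).2

theorem two_le_card_of_hits {α : Type*} [DecidableEq α] {C : Clutter α} {T J X : Finset α}
    (hTne : T.Nonempty) (hsing : ∀ x ∈ T, ¬ C.Hits (insert x J)) (hX : X ⊆ T)
    (hhit : C.Hits (X ∪ J)) : 2 ≤ X.card := by
  by_contra! h
  obtain ⟨t, ht⟩ := hTne
  obtain ⟨x, hx, hXx⟩ : ∃ x ∈ T, X ⊆ {x} := by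
    rcases X.eq_empty_or_nonempty with rfl | ⟨x, hx⟩
    -- If `J` alone hit everything, so would `J` with any element of `T`; this is where `T` must be
    -- nonempty.
    · exact ⟨t, ht, Finset.empty_subset _⟩
    · exact ⟨x, hX hx, fun y hy => Finset.mem_singleton.mpr
        (Finset.card_le_one.mp (by omega) y hy x hx)⟩
  exact hsing x hx (hhit.mono (Finset.union_subset_union_left hXx))

/-- In a clean clutter, the two-element covers contain no odd closed walk; stated after
deleting `J`. -/
theorem IsClean.no_odd_closed {α : Type*} [DecidableEq α] {C : Clutter α} (hC : C.IsClean)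
    {J T : Finset α} (hJ : J ⊆ C.ground) (hT : T ⊆ C.ground) (hTJ : Disjoint T J)
    (hsing : ∀ x ∈ T, ¬ C.Hits (insert x J)) {n : ℕ} (hn : Odd n) (a : ℕ → α)
    (haT : ∀ i ≤ n, a i ∈ T)
    (ha : ∀ i < n, C.Hits (insert (a i) (insert (a (i + 1)) J))) (hclosed : a n = a 0) :
    False := by
  obtain ⟨m, h3, hm, b, hbT, hb, hbc, hinj, hch⟩ := exists_chordless_odd_closed
    -- Membership in `T` is built into the relation because `hsing`, which gives irreflexivity,
    -- concerns only elements of `T`.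
    (fun x y => x ∈ T ∧ C.Hits (insert x (insert y J)) ∧ y ∈ T)
    (fun x y h => ⟨h.2.2, by rw [Finset.insert_comm]; exact h.2.1, h.1⟩)
    (fun x h => hsing x h.1 (by simpa using h.2.1)) hn a
    (fun i hi => ⟨haT i hi.le, ha i hi, haT _ hi⟩) hclosed
  replace hbT : ∀ i ≤ m, b i ∈ T := fun i hi => by
    obtain ⟨j, hj, h⟩ := hbT i hi
    exact h ▸ haT j hj
  replace hb : ∀ i < m, C.Hits (insert (b i) (insert (b (i + 1)) J)) := fun i hi => (hb i hi).2.1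
  replace hch : ∀ i j, i < j → j < m → C.Hits (insert (b i) (insert (b j) J)) →
      j = i + 1 ∨ (i = 0 ∧ j = m - 1) := fun i j hij hj h =>
    hch i j hij hj ⟨hbT _ (by omega), h, hbT _ hj.le⟩
  have hne : T.Nonempty := ⟨_, hbT 0 (by omega)⟩
  -- A triangle contradicts the delta lemma: `b 0` is paired with both elements of the minimal cover
  -- `{b 1, b 2}`.
  rcases h3.eq_or_lt with rfl | h4
  · have hpair : ({b 1, b 2} : Finset α) ⊆ T :=
      Finset.insert_subset (hbT 1 (by omega)) (by simpa using hbT 2 (by omega))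
    have h12 := hinj 1 2 (by omega) (by omega)
    refine h12 (hC.eq_of_hits_pairs hJ (hpair.trans hT) (hT (hbT 0 (by omega)))
      (Finset.disjoint_of_subset_left hpair hTJ) ?_ ?_ ?_ ?_ (hsing _ (hbT 0 (by omega)))
      (Finset.mem_insert_self _ _) (Finset.mem_insert_of_mem (Finset.mem_singleton_self _))
      (hb 0 (by omega)) ?_)
    · have h01 := hinj 0 1 (by omega) (by omega)
      have h02 := hinj 0 2 (by omega) (by omega)
      simp [h01, h02]
    · exact Finset.disjoint_left.mp hTJ (hbT 0 (by omega))
    · exact (hb 1 (by omega)).mono (by simp)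
    · intro X hX hhit
      refine Finset.eq_of_subset_of_card_le hX ?_
      rw [Finset.card_pair h12]
      exact two_le_card_of_hits hne hsing (hX.trans hpair) hhit
    · rw [Finset.insert_comm, ← hbc]
      exact hb 2 (by omega)
  have h5 : 5 ≤ m := by grind
  have hST : (Finset.range m).image b ⊆ T := by
    intro x hx
    obtain ⟨i, hi, rfl⟩ := Finset.mem_image.mp hx
    exact hbT i (Finset.mem_range.mp hi).le
  have hS := hST.trans hT
  have hSJ := Finset.disjoint_of_subset_left hST hTJ
  -- After contracting everything off the cycle, the absence of chords makes its edges the only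
  -- two-element covers. The blocker of this minor is thus an extended odd hole, and the minor is
  -- the blocker of its blocker.
  refine (hC _ (minor_isMinor C (S := (Finset.range m).image b) hJ)).2
    ⟨_, ?_, (blocker_blocker _).symm⟩
  set D := C.minor J (C.ground \ ((Finset.range m).image b ∪ J)) with hD
  have hcov : ∀ X, D.IsCover X ↔ X ⊆ (Finset.range m).image b ∧ C.Hits (X ∪ J) :=
    fun X => minor_isCover_iff C hS hSJ
  have htwo : ∀ X, D.IsCover X → 2 ≤ X.card := fun X hX =>
    two_le_card_of_hits hne hsing (((hcov X).mp hX).1.trans hST) ((hcov X).mp hX).2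
  have : NeZero m := ⟨by omega⟩
  have hmem : ∀ i : ZMod m, b i.val ∈ (Finset.range m).image b := fun i =>
    Finset.mem_image_of_mem _ (Finset.mem_range.mpr i.val_lt)
  have hinj' : Function.Injective fun i : ZMod m => b i.val := by
    intro i j hij
    refine ZMod.val_injective m ?_
    rcases lt_trichotomy i.val j.val with h | h | h
    · exact absurd hij (hinj _ _ h j.val_lt)
    · exact h
    · exact absurd hij.symm (hinj _ _ h i.val_lt)
  have hone : ∀ i : ZMod m, i ≠ i + 1 := by
    intro i h
    have : (1 : ZMod m) = 0 := by simpa using h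
    have := congrArg ZMod.val this
    rw [ZMod.val_one'' (by omega), ZMod.val_zero] at this
    omega
  have hsucc : ∀ i : ZMod m, b (i + 1).val = b (i.val + 1) := by
    intro i
    rw [ZMod.val_add, ZMod.val_one'' (by omega)]
    rcases (Nat.succ_le_of_lt i.val_lt).eq_or_lt with h | h
    · rw [Nat.succ_eq_add_one] at h
      rw [h, Nat.mod_self, hbc]
    · rw [Nat.mod_eq_of_lt h]
  have hedge : ∀ i : ZMod m, D.IsCover {b i.val, b (i + 1).val} := by
    intro i
    rw [hcov]
    refine ⟨Finset.insert_subset (hmem _) (Finset.singleton_subset_iff.mpr (hmem _)), ?_⟩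
    rw [hsucc]
    exact (hb _ i.val_lt).mono (by simp)
  have hedgecard : ∀ i : ZMod m, ({b i.val, b (i + 1).val} : Finset α).card = 2 := fun i =>
    Finset.card_pair (hinj'.ne (hone i))
  have hedgemin : ∀ i : ZMod m, D.IsMinimalCover {b i.val, b (i + 1).val} := fun i =>
    ⟨hedge i, fun B hB hBA =>
      (Finset.eq_of_subset_of_card_le hBA ((hedgecard i).le.trans (htwo B hB))).ge⟩
  refine ⟨m, h5, hm, fun i => b i.val, hinj', ?_, ?_⟩
  · rw [show D.blocker.ground = (Finset.range m).image b from minor_ground_of_subset C hS hSJ]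
    ext x
    simp only [Set.mem_range, Finset.coe_image, Finset.coe_range, Set.mem_image, Set.mem_Iio]
    constructor
    · rintro ⟨i, rfl⟩
      exact ⟨i.val, i.val_lt, rfl⟩
    · rintro ⟨i, hi, rfl⟩
      exact ⟨i, by rw [ZMod.val_natCast_of_lt hi]⟩
  · ext A
    simp only [Set.mem_ofPred_eq, Set.mem_range]
    constructor
    · rintro ⟨hA, hAmin⟩
      have hAc := hA.prop
      have hA2 : A.card = 2 := le_antisymm
        ((hAmin _ (hedgemin 0)).trans (hedgecard 0).le) (htwo A hAc)
      obtain ⟨x, y, hxy, rfl⟩ := Finset.card_eq_two.mp hA2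
      obtain ⟨hsub, hhit⟩ := (hcov _).mp hAc
      obtain ⟨i, hi, rfl⟩ := Finset.mem_image.mp (hsub (Finset.mem_insert_self _ _))
      obtain ⟨j, hj, rfl⟩ := Finset.mem_image.mp
        (hsub (Finset.mem_insert_of_mem (Finset.mem_singleton_self _)))
      have hwlog : ∀ i j, i < j → j < m → C.Hits ({b i, b j} ∪ J) →
          ∃ z : ZMod m, ({b z.val, b (z + 1).val} : Finset α) = {b i, b j} := by
        intro i j hij hj h
        rcases hch i j hij hj (h.mono (by simp)) with rfl | ⟨rfl, rfl⟩
        · exact ⟨i, by rw [hsucc, ZMod.val_natCast_of_lt (by omega)]⟩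
        · refine ⟨((m - 1 : ℕ) : ZMod m), ?_⟩
          rw [hsucc, ZMod.val_natCast_of_lt (by omega), Nat.sub_add_cancel (by omega), hbc,
            Finset.pair_comm]
      rw [Finset.mem_range] at hi hj
      rcases lt_trichotomy i j with h | rfl | h
      · exact hwlog i j h hj hhit
      · exact absurd rfl hxy
      · rw [Finset.pair_comm] at hhit ⊢
        exact hwlog j i h hi hhit
    · rintro ⟨i, rfl⟩
      exact ⟨hedgemin i, fun B hB => (hedgecard i).le.trans (htwo B (Minimal.prop hB))⟩

/-! ### Alternating walks -/

/-- Let `M` be a cover of minimum cardinality among those contained in `W`. Two distinct elements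
of `M` are not joined by a walk of two-element covers that alternates between `W` and its
complement; stated after deleting `J`. -/
theorem IsClean.no_alternating_walk {α : Type*} [DecidableEq α] {C : Clutter α} (hC : C.IsClean)
    {W : Set α} {n : ℕ} (hn : Even n) {J M S : Finset α} (p : ℕ → α)
    (hJ : J ⊆ C.ground) (hS : S ⊆ C.ground) (hSJ : Disjoint S J)
    (hsing : ∀ x ∈ S, ¬ C.Hits (insert x J)) (hMS : M ⊆ S) (hMW : ↑M ⊆ W)
    (hMhit : C.Hits (M ∪ J))
    (hmin : ∀ X ⊆ S, ↑X ⊆ W → C.Hits (X ∪ J) → M.card ≤ X.card)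
    (h0 : p 0 ∈ M) (hnM : p n ∈ M) (hne : p 0 ≠ p n)
    (hpS : ∀ i ≤ n, p i ∈ S) (heven : ∀ i ≤ n, Even i → p i ∈ W)
    (hodd : ∀ i ≤ n, Odd i → p i ∉ W)
    (hp : ∀ i < n, C.Hits (insert (p i) (insert (p (i + 1)) J))) : False := by
  induction n using Nat.strong_induction_on generalizing J M S p with
  | _ n ih =>
  -- All hypotheses survive shrinking `S` to `M` and the walk; afterwards an element of `S` outside
  -- `W` must lie on the walk.
  wlog hSp : ∀ y ∈ S, y ∈ M ∨ ∃ i ≤ n, p i = y generalizing S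
  · classical
    have hsub : S.filter (fun y => y ∈ M ∨ ∃ i ≤ n, p i = y) ⊆ S := Finset.filter_subset _ _
    refine this (S := S.filter (fun y => y ∈ M ∨ ∃ i ≤ n, p i = y)) (hsub.trans hS)
      (Finset.disjoint_of_subset_left hsub hSJ) (fun x hx => hsing x (hsub hx))
      (fun x hx => Finset.mem_filter.mpr ⟨hMS hx, Or.inl hx⟩)
      (fun X hX => hmin X (hX.trans hsub))
      (fun i hi => Finset.mem_filter.mpr ⟨hpS i hi, Or.inr ⟨i, hi, rfl⟩⟩)
      (fun y hy => (Finset.mem_filter.mp hy).2)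
  by_cases hint : ∃ i, 0 < i ∧ i < n ∧ p i ∈ M
  -- Cut the walk at an interior vertex in `M`, keeping a part whose ends are still distinct.
  · obtain ⟨i, hi0, hin, hiM⟩ := hint
    have hie : Even i := by
      by_contra h
      exact hodd i hin.le (Nat.not_even_iff_odd.mp h) (hMW hiM)
    by_cases hpi : p 0 = p i
    · refine ih (n - i) (by omega) (by grind) (fun k => p (i + k)) hJ hS hSJ hsing hMS hMW hMhit
        hmin hiM ?_ ?_ (fun k hk => hpS _ (by omega)) (fun k hk h => heven _ (by omega) (hie.add h))
        (fun k hk h => hodd _ (by omega) (hie.add_odd h)) (fun k hk => hp (i + k) (by omega))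
      · simpa [hin.le] using hnM
      · simpa [hin.le, ← hpi] using hne
    · exact ih i hin hie p hJ hS hSJ hsing hMS hMW hMhit hmin h0 hiM hpi
        (fun k hk => hpS _ (by omega)) (fun k hk => heven _ (by omega))
        (fun k hk => hodd _ (by omega)) (fun k hk => hp _ (by omega))
  push Not at hint
  have hn0 : n ≠ 0 := by
    rintro rfl
    exact hne rfl
  rcases eq_or_ne n 2 with rfl | hn2
  · refine hne (hC.eq_of_hits_pairs (u := p 1) hJ (hMS.trans hS) (hS (hpS 1 (by omega)))
      (Finset.disjoint_of_subset_left hMS hSJ) (hint 1 (by omega) (by omega))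
      (Finset.disjoint_left.mp hSJ (hpS 1 (by omega))) hMhit ?_ (hsing _ (hpS 1 (by omega)))
      h0 hnM ?_ (hp 1 (by omega)))
    · intro X hX hhit
      exact Finset.eq_of_subset_of_card_le hX (hmin X (hX.trans hMS)
        ((Finset.coe_subset.mpr hX).trans hMW) hhit)
    · rw [Finset.insert_comm]
      exact hp 0 (by omega)
  have hn4 : 4 ≤ n := by grind
  classical
  -- `K` is a maximal part of `M`, avoiding both ends, whose deletion creates no one-element cover
  -- in `S`.
  obtain ⟨K, hK⟩ := (((M.erase (p 0)).erase (p n)).powerset.filter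
    fun K => ∀ y ∈ S, ¬ C.Hits (insert y (K ∪ J))).exists_maximal ⟨∅, by simpa using hsing⟩
  obtain ⟨hKM', hKS⟩ : K ⊆ (M.erase (p 0)).erase (p n) ∧ ∀ y ∈ S, ¬ C.Hits (insert y (K ∪ J)) := by
    simpa using hK.prop
  have hKM : K ⊆ M := hKM'.trans ((Finset.erase_subset _ _).trans (Finset.erase_subset _ _))
  have h0K : p 0 ∉ K := fun h => by simpa using hKM' h
  have hnK : p n ∉ K := fun h => by simpa using hKM' h
  have hJ' : K ∪ J ⊆ C.ground := Finset.union_subset (hKM.trans (hMS.trans hS)) hJ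
  have hS' : S \ K ⊆ C.ground := Finset.sdiff_subset.trans hS
  have hSJ' : Disjoint (S \ K) (K ∪ J) := by
    rw [Finset.disjoint_union_right]
    exact ⟨Finset.sdiff_disjoint, Finset.disjoint_of_subset_left Finset.sdiff_subset hSJ⟩
  have hsing' : ∀ x ∈ S \ K, ¬ C.Hits (insert x (K ∪ J)) := fun x hx =>
    hKS x (Finset.mem_sdiff.mp hx).1
  have hpK : ∀ i ≤ n, p i ∈ S \ K := by
    refine fun i hi => Finset.mem_sdiff.mpr ⟨hpS i hi, fun h => ?_⟩
    rcases Nat.eq_zero_or_pos i with rfl | h0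
    · exact h0K h
    · rcases hi.eq_or_lt with rfl | hin
      · exact hnK h
      · exact hint i h0 hin (hKM h)
  have hp' : ∀ i < n, C.Hits (insert (p i) (insert (p (i + 1)) (K ∪ J))) := fun i hi =>
    (hp i hi).mono (Finset.insert_subset_insert _ (Finset.insert_subset_insert _
      Finset.subset_union_right))
  by_cases hMK : ∃ x ∈ M, x ∉ K ∧ x ≠ p 0 ∧ x ≠ p n
  · obtain ⟨x, hxM, hxK, hx0, hxn⟩ := hMK
    obtain ⟨y, hyS, hyx⟩ : ∃ y ∈ S, C.Hits (insert y (insert x (K ∪ J))) := by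
      by_contra! h
      refine hxK (hK.le_of_ge (y := insert x K) ?_ (Finset.subset_insert _ _)
        (Finset.mem_insert_self _ _))
      simp only [Finset.mem_filter, Finset.mem_powerset, Finset.insert_union]
      refine ⟨Finset.insert_subset ?_ hKM', h⟩
      simp [hxM, hx0, hxn]
    have hcard : K.card + 3 ≤ M.card := by
      have hsub : insert (p 0) (insert (p n) (insert x K)) ⊆ M := by
        simp only [Finset.insert_subset_iff]
        exact ⟨h0, hnM, hxM, hKM⟩
      have := Finset.card_le_card hsub
      rwa [Finset.card_insert_of_notMem (by simp [hne, hx0.symm, h0K]),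
        Finset.card_insert_of_notMem (by simp [hxn.symm, hnK]),
        Finset.card_insert_of_notMem hxK] at this
    -- Otherwise `K ∪ {x, y}` would yield a cover inside `W` with at most `|K| + 2 < |M|` elements.
    have hyW : y ∉ W := by
      intro hyW
      have h1 := hmin (insert y (insert x K))
        (Finset.insert_subset hyS (Finset.insert_subset (hMS hxM) (hKM.trans hMS))) ?_
        (by simpa only [Finset.insert_union] using hyx)
      · have h2 := Finset.card_insert_le y (insert x K)
        have h3 := Finset.card_insert_le x K
        omega
      · simp only [Finset.coe_insert, Set.insert_subset_iff]
        exact ⟨hyW, hMW hxM, (Finset.coe_subset.mpr hKM).trans hMW⟩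
    obtain ⟨i, hi, rfl⟩ := (hSp y hyS).resolve_left fun h => hyW (hMW h)
    have hio : Odd i := Nat.not_even_iff_odd.mp fun h => hyW (heven i hi h)
    have hi_lt : i < n := lt_of_le_of_ne hi fun h => by grind
    have hi_pos : 0 < i := hio.pos
    have hMS' : M \ K ⊆ S \ K := Finset.sdiff_subset_sdiff hMS subset_rfl
    have hMW' : ↑(M \ K) ⊆ W := (Finset.coe_subset.mpr Finset.sdiff_subset).trans hMW
    have hMhit' : C.Hits (M \ K ∪ (K ∪ J)) := by
      rwa [← Finset.union_assoc, Finset.sdiff_union_of_subset hKM]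
    have hmin' : ∀ X ⊆ S \ K, ↑X ⊆ W → C.Hits (X ∪ (K ∪ J)) → (M \ K).card ≤ X.card := by
      intro X hX hXW hhit
      rw [← Finset.union_assoc] at hhit
      have h1 := hmin (X ∪ K) (Finset.union_subset (hX.trans Finset.sdiff_subset) (hKM.trans hMS))
        (by
          rw [Finset.coe_union]
          exact Set.union_subset hXW ((Finset.coe_subset.mpr hKM).trans hMW)) hhit
      have h2 := Finset.card_union_le X K
      rw [Finset.card_sdiff_of_subset hKM]
      omega
    have hxMK : x ∈ M \ K := Finset.mem_sdiff.mpr ⟨hxM, hxK⟩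
    have hxW : x ∈ W := hMW hxM
    -- The new pair `{p i, x}` gives a shorter alternating walk: `p 0, …, p i, x` between the
    -- elements `p 0` and `x` of `M \ K`.
    by_cases hin : i + 1 < n
    · refine ih (i + 1) hin hio.add_one (fun k => if k ≤ i then p k else x) hJ' hS' hSJ' hsing'
        hMS' hMW' hMhit' hmin' ?_ ?_ ?_ (fun k hk => ?_) (fun k hk h => ?_) (fun k hk h => ?_)
        (fun k hk => ?_)
      · simpa using ⟨h0, h0K⟩
      · simpa using ⟨hxM, hxK⟩
      · simpa using hx0.symm
      · by_cases h : k ≤ i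
        · simpa only [h, if_true] using hpK k (by omega)
        · simpa only [h, if_false] using hMS' hxMK
      · by_cases h' : k ≤ i
        · simpa only [h', if_true] using heven k (by omega) h
        · simpa only [h', if_false] using hxW
      · have h' : k ≤ i := by grind
        simpa only [h', if_true] using hodd k (by omega) h
      · rcases (Nat.lt_succ_iff.mp hk).eq_or_lt with rfl | h
        · simpa using hyx
        · simpa [h.le, Nat.succ_le_of_lt h] using hp' k (by omega)
    -- Here that walk would have length `n`, so `x, p (n - 1), p n` is used instead; its length 2 is
    -- smaller since `n ≥ 4`.
    · obtain rfl : n = i + 1 := by omega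
      refine ih 2 (by omega) even_two (fun k => if k = 0 then x else p (i - 1 + k)) hJ' hS' hSJ'
        hsing' hMS' hMW' hMhit' hmin' ?_ ?_ ?_ (fun k hk => ?_) (fun k hk h => ?_)
        (fun k hk h => ?_) (fun k hk => ?_)
      · simpa using ⟨hxM, hxK⟩
      · simpa [show i - 1 + 2 = i + 1 by omega] using ⟨hnM, hnK⟩
      · simpa [show i - 1 + 2 = i + 1 by omega] using hxn
      · by_cases h : k = 0
        · simpa only [h, if_true] using hMS' hxMK
        · simpa only [h, if_false] using hpK (i - 1 + k) (by omega)
      · by_cases h' : k = 0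
        · simpa only [h', if_true] using hxW
        · simpa only [h', if_false] using heven (i - 1 + k) (by omega) (by grind)
      · have h' : k ≠ 0 := by grind
        simpa only [h', if_false] using hodd (i - 1 + k) (by omega) (by grind)
      · rcases Nat.eq_zero_or_pos k with rfl | h
        · rw [Finset.insert_comm]
          simpa [show i - 1 + 1 = i by omega] using hyx
        · obtain rfl : k = 1 := by omega
          simpa [show i - 1 + 1 = i by omega, show i - 1 + 2 = i + 1 by omega] using hp' i hi_lt
  -- Now `M` is `K` with the two ends, so after deleting `K` the pair `{p 0, p n}` is a cover and
  -- closes the even walk into an odd one.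
  · push Not at hMK
    refine hC.no_odd_closed hJ' hS' hSJ' hsing' (n := n + 1) hn.add_one
      (fun i => if i ≤ n then p i else p 0) (fun i hi => ?_) (fun i hi => ?_) (by simp)
    · by_cases h : i ≤ n
      · simpa [h] using hpK i h
      · simpa [h] using hpK 0 (by omega)
    · rcases (Nat.lt_succ_iff.mp hi).eq_or_lt with rfl | h
      · simp only [le_refl, if_true, show ¬ i + 1 ≤ i by omega, if_false]
        refine hMhit.mono fun z hz => ?_
        rcases Finset.mem_union.mp hz with hz | hz
        · have := hMK z hz
          simp only [Finset.mem_insert, Finset.mem_union]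
          tauto
        · simp [hz]
      · simpa [h.le, Nat.succ_le_of_lt h] using hp' i h

/-! ### Sides of the components of the graph -/

theorem IsTangled.two_le_card {α : Type*} {C : Clutter α} (hC : C.IsTangled) {B : Finset α}
    (hB : C.IsCover B) : 2 ≤ B.card := by
  have h : C.coveringNumber ≤ (B.card : ℕ∞) := iInf₂_le B hB
  rw [hC.1] at h
  exact_mod_cast h

theorem IsTangled.isMinimumCover {α : Type*} {C : Clutter α} (hC : C.IsTangled) {B : Finset α}
    (hB : C.IsCover B) (hcard : B.card = 2) : C.IsMinimumCover B :=
  ⟨hB, fun _ hB' => hcard.le.trans (hC.two_le_card hB')⟩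

theorem IsComponentBipartition.mem_supp {α : Type*} [DecidableEq α] {C : Clutter α}
    {K : C.graph.ConnectedComponent} {U V : Finset α} (h : C.IsComponentBipartition K U V)
    {x : α} (hx : x ∈ U ∪ V) : ∃ hxC : x ∈ C.ground, (⟨x, hxC⟩ : {v // v ∈ C.ground}) ∈ K.supp := by
  have : x ∈ ((U ∪ V : Finset α) : Set α) := hx
  rw [h.2.1] at this
  obtain ⟨y, hy, rfl⟩ := this
  exact ⟨y.2, hy⟩

theorem IsComponentBipartition.getVert_mem {α : Type*} [DecidableEq α] {C : Clutter α}
    {K : C.graph.ConnectedComponent} {U V : Finset α} (h : C.IsComponentBipartition K U V)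
    {x y : {v // v ∈ C.ground}} (p : C.graph.Walk x y) (hx : x ∈ K.supp) (hxV : x.1 ∈ V)
    {i : ℕ} (hi : i ≤ p.length) :
    p.getVert i ∈ K.supp ∧ (Even i → (p.getVert i).1 ∈ V) ∧ (Odd i → (p.getVert i).1 ∈ U) := by
  induction i with
  | zero => simpa using ⟨hx, hxV⟩
  | succ i ih =>
    obtain ⟨h1, h2, h3⟩ := ih (by omega)
    have hadj := p.adj_getVert_succ (i := i) (by omega)
    refine ⟨K.mem_supp_of_adj_mem_supp h1 hadj, fun he => ?_, fun ho => ?_⟩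
    · have hU := h3 (by grind)
      rcases h.2.2 _ _ h1 hadj with h' | h'
      · exact h'.2
      · exact absurd h'.1 (Finset.disjoint_left.mp h.1 hU)
    · have hV := h2 (by grind)
      rcases h.2.2 _ _ h1 hadj with h' | h'
      · exact absurd hV (Finset.disjoint_left.mp h.1 h'.1)
      · exact h'.2

theorem IsComponentBipartition.eq_of_mem {α : Type*} [DecidableEq α] {C : Clutter α}
    {K K' : C.graph.ConnectedComponent} {U V U' V' : Finset α}
    (h : C.IsComponentBipartition K U V) (h' : C.IsComponentBipartition K' U' V') {x : α}
    (hx : x ∈ U ∪ V) (hx' : x ∈ U' ∪ V') : K = K' := by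
  obtain ⟨h1, h2⟩ := h.mem_supp hx
  obtain ⟨_, h3⟩ := h'.mem_supp hx'
  rw [SimpleGraph.ConnectedComponent.mem_supp_iff] at h2 h3
  exact h2.symm.trans h3

/-- A cover of minimum cardinality among those contained in a union of sides of components meets
each of these sides at most once. -/
theorem IsClean.card_inter_le_one {α : Type*} [DecidableEq α] {C : Clutter α} (hC : C.IsClean)
    (htangled : C.IsTangled) {ι : Type*} {K : ι → C.graph.ConnectedComponent}
    (hK : Function.Injective K) {U V : ι → Finset α}
    (hUV : ∀ i, C.IsComponentBipartition (K i) (U i) (V i)) {s : Finset ι} {M : Finset α}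
    (hM : C.IsCover M) (hMV : M ⊆ s.biUnion V)
    (hmin : ∀ X ⊆ s.biUnion V, C.IsCover X → M.card ≤ X.card) {i : ι} (hi : i ∈ s) :
    (M ∩ V i).card ≤ 1 := by
  rw [Finset.card_le_one]
  intro v hv w hw
  rw [Finset.mem_inter] at hv hw
  by_contra hvw
  -- Distinct indices are distinct components, so `U i` avoids every `V j`; hence a walk alternating
  -- between `V i` and `U i` also alternates between the whole union and its complement.
  have hUnot : ∀ x ∈ U i, x ∉ s.biUnion V := by
    intro x hx hxV
    obtain ⟨j, -, hj⟩ := Finset.mem_biUnion.mp hxV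
    obtain rfl := hK ((hUV i).eq_of_mem (hUV j) (Finset.mem_union_left _ hx)
      (Finset.mem_union_right _ hj))
    exact Finset.disjoint_left.mp (hUV i).1 hx hj
  obtain ⟨hvC, hvK⟩ := (hUV i).mem_supp (Finset.mem_union_right _ hv.2)
  obtain ⟨hwC, hwK⟩ := (hUV i).mem_supp (Finset.mem_union_right _ hw.2)
  obtain ⟨p⟩ := (K i).reachable_of_mem_supp hvK hwK
  have hp := fun j (hj : j ≤ p.length) => (hUV i).getVert_mem p hvK hv.2 hj
  have heven : Even p.length := by
    by_contra h
    have := (hp _ le_rfl).2.2 (Nat.not_even_iff_odd.mp h)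
    rw [p.getVert_length] at this
    exact Finset.disjoint_left.mp (hUV i).1 this hw.2
  refine hC.no_alternating_walk (W := ↑(s.biUnion V)) heven (J := ∅) (M := M) (S := C.ground)
    (fun j => (p.getVert j).1) (Finset.empty_subset _) subset_rfl (Finset.disjoint_empty_right _)
    (fun x hx hhit => ?_) hM.1 (Finset.coe_subset.mpr hMV)
    (by rw [Finset.union_empty]; exact hM.2)
    (fun X hX hXV hhit => hmin X (Finset.coe_subset.mp hXV)
      ⟨hX, by rw [Finset.union_empty] at hhit; exact hhit⟩)
    (by simpa using hv.1) (by simpa using hw.1) (by simpa using hvw) (fun j _ => (p.getVert j).2)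
    (fun j hj h => Finset.mem_biUnion.mpr ⟨i, hi, (hp j hj).2.1 h⟩)
    (fun j hj h => hUnot _ ((hp j hj).2.2 h)) (fun j hj => ?_)
  · have := htangled.two_le_card ⟨Finset.singleton_subset_iff.mpr hx, hhit⟩
    simp at this
  · exact (p.adj_getVert_succ hj).2.1.2

/-- No two-element cover is contained in a union of sides of components, one side for each. -/
theorem IsTangled.three_le_card {α : Type*} [DecidableEq α] {C : Clutter α}
    (htangled : C.IsTangled) {ι : Type*} {K : ι → C.graph.ConnectedComponent}
    (hK : Function.Injective K) {U V : ι → Finset α}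
    (hUV : ∀ i, C.IsComponentBipartition (K i) (U i) (V i)) {s : Finset ι} {M : Finset α}
    (hM : C.IsCover M) (hMV : M ⊆ s.biUnion V) : 3 ≤ M.card := by
  by_contra! h
  have h2 : M.card = 2 := by
    have := htangled.two_le_card hM
    omega
  obtain ⟨x, y, hxy, rfl⟩ := Finset.card_eq_two.mp h2
  obtain ⟨i, -, hxi⟩ := Finset.mem_biUnion.mp (hMV (Finset.mem_insert_self x _))
  obtain ⟨j, -, hyj⟩ := Finset.mem_biUnion.mp
    (hMV (Finset.mem_insert_of_mem (Finset.mem_singleton_self y)))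
  obtain ⟨hxC, hxK⟩ := (hUV i).mem_supp (Finset.mem_union_right _ hxi)
  obtain ⟨hyC, hyK⟩ := (hUV j).mem_supp (Finset.mem_union_right _ hyj)
  have hadj : C.graph.Adj ⟨x, hxC⟩ ⟨y, hyC⟩ :=
    ⟨fun h => hxy (congrArg Subtype.val h), htangled.isMinimumCover hM h2⟩
  rcases (hUV i).2.2 _ _ hxK hadj with h | h
  · exact Finset.disjoint_left.mp (hUV i).1 h.1 hxi
  · obtain rfl := hK ((hUV i).eq_of_mem (hUV j) (Finset.mem_union_left _ h.2)
      (Finset.mem_union_right _ hyj))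
    exact Finset.disjoint_left.mp (hUV i).1 h.2 hyj

end Clutter

/-! ### The counting argument -/

theorem mainTheorem9 {α : Type*} [DecidableEq α] (C : Clutter α)
    (hclean : C.IsClean) (htangled : C.IsTangled)
    (comp : Fin C.rank ≃ C.graph.ConnectedComponent)
    (U V : Fin C.rank → Finset α)
    (hUV : ∀ i, C.IsComponentBipartition (comp i) (U i) (V i))
    (k : ℕ) (hk1 : 1 ≤ k) (hkr : k ≤ C.rank)
    (hcover : C.IsCover (({i : Fin C.rank | i.val < k} : Finset (Fin C.rank)).biUnion V)) :
    3 ≤ k ∧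
      (k = 3 → ∃ B : Finset α, C.IsMinimalCover B ∧ B.card = 3 ∧
        B ⊆ ({i : Fin C.rank | i.val < 3} : Finset (Fin C.rank)).biUnion V ∧
        ∀ i : Fin C.rank, i.val < 3 → (B ∩ V i).card = 1) := by
  classical
  set s : Finset (Fin C.rank) := {i : Fin C.rank | i.val < k} with hs
  have hscard : s.card ≤ k := by
    have := Finset.card_le_card_of_injOn (s := s) (t := Finset.range k) Fin.val
      (fun i hi => by simpa [hs] using hi) Fin.val_injective.injOn
    simpa using this
  obtain ⟨M, hM, hMmin⟩ := ((s.biUnion V).powerset.filter C.IsCover).exists_min_image Finset.card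
    ⟨s.biUnion V, by simpa using hcover⟩
  obtain ⟨hMV, hMc⟩ : M ⊆ s.biUnion V ∧ C.IsCover M := by simpa using hM
  have hmin : ∀ X ⊆ s.biUnion V, C.IsCover X → M.card ≤ X.card := fun X hX hXc =>
    hMmin X (by simpa using ⟨hX, hXc⟩)
  have h3 := htangled.three_le_card comp.injective hUV hMc hMV
  have hone : ∀ i ∈ s, (M ∩ V i).card ≤ 1 := fun i hi =>
    hclean.card_inter_le_one htangled comp.injective hUV hMc hMV hmin hi
  have hsum : M.card ≤ ∑ i ∈ s, (M ∩ V i).card := by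
    refine le_trans (Finset.card_le_card ?_) Finset.card_biUnion_le
    rw [← Finset.inter_biUnion]
    exact Finset.subset_inter subset_rfl hMV
  have hsum' : ∑ i ∈ s, (M ∩ V i).card ≤ s.card := by
    simpa using Finset.sum_le_sum hone
  refine ⟨by omega, ?_⟩
  rintro rfl
  refine ⟨M, ⟨hMc, fun B hB hBM => ?_⟩, by omega, hMV, fun i hi => ?_⟩
  · exact (Finset.eq_of_subset_of_card_le hBM (hmin B (hBM.trans hMV) hB)).ge
  · refine le_antisymm (hone i (by simpa [hs] using hi)) ?_
    -- A missed side would give `|M| < |s| ≤ 3`, against `|M| ≥ 3`.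
    by_contra! h0
    have hlt : ∑ i ∈ s, (M ∩ V i).card < ∑ i ∈ s, 1 :=
      Finset.sum_lt_sum hone ⟨i, by simpa [hs] using hi, h0⟩
    simp only [Finset.sum_const, smul_eq_mul, mul_one] at hlt
    omega
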